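/- For each $N\ge 1$ let $\mathbf y_1,\dots,\mathbf y_N$ be i.i.d. standard Gaussian vectors in $\mathbb R^N$ (each $\mathbf y_i\sim\mathcal N(0,\mathrm{Id}_{N\times N})$), with entries $y_{ij}=(\mathbf y_i)_j$, and let $$\mathbf w_i=\mathbf y_i-\sum_{\ell=1}^{i-1}\frac{\langle \mathbf y_i,\mathbf w_\ell\rangle}{\|\mathbf w_\ell\|^2}\,\mathbf w_\ell ,\qquad \boldsymbol\gamma_i=\frac{\mathbf w_i}{\|\mathbf w_i\|},\qquad \gamma_{ij}=(\boldsymbol\gamma_i)_j ,\qquad i,j=1,\dots,N,$$ be their Gram–Schmidt orthogonalizations and orthonormalizations (almost surely well defined). Fix $\delta>0$ and a sequence $(k_N)_{N\ge1}$ of positive integers with $k_N=O(N^{1/2-\delta})$, i.e. there is a constant $C$ with $k_N\le C N^{1/2-\delta}$ for all $N\ge 1$. For each positive integer $k$ let $(a_1^{(k)},\dots,a_k^{(k)})$ be a $k$-tuple of deterministic real numbers, and suppose that there is $a>0$, independent of $N$ and of $k$, with $|a_i^{(k)}|\le a$ for all $k\ge 1$ and $1\le i\le k$. Then, writing $k=k_N$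 and $a_i=a_i^{(k_N)}$, $$\max_{1\le j\le N}\Bigl|\sum_{i=1}^{k}a_i\bigl(\sqrt N\,\gamma_{ij}\bigr)^2\Bigr|-\max_{1\le j\le N}\Bigl|\sum_{i=1}^{k}a_i\,y_{ij}^2\Bigr|\;\longrightarrow\;0\quad\text{in probability as }N\to\infty,$$ and $$\max_{1\le j\le N}\Bigl(\sum_{i=1}^{k}a_i\bigl(\sqrt N\,\gamma_{ij}\bigr)^2\Bigr)-\max_{1\le j\le N}\Bigl(\sum_{i=1}^{k}a_i\,y_{ij}^2\Bigr)\;\longrightarrow\;0\quad\text{in probability as }N\to\infty.$$ (For the at most finitely many $N$ with $k_N>N$, where the vectors with index $i>N$ are not defined, the sums are taken over $i\le N$ only.) -/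

import Mathlib

open MeasureTheory ProbabilityTheory Filter Topology

/-- Convergence to `0` in probability of a sequence of real random variables `X N`, where `X N` may
live on its own probability space `(Ω N, P N)`: for all `ε > 0`, `P N (|X N| ≥ ε) → 0`. -/
def TendstoZeroInProb {Ω : ℕ → Type*} [∀ N, MeasurableSpace (Ω N)]
    (P : ∀ N, Measure (Ω N)) (X : ∀ N, Ω N → ℝ) : Prop :=
  ∀ ε : ℝ, 0 < ε → Tendsto (fun N => P N {ω | ε ≤ |X N ω|}) atTop (𝓝 0)

/-- The quadratic form `∑ i, a_i (v_i)_j ^ 2`, where `i` runs over the first `k` indices (counted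
from `0`) of the vectors `v_0, …, v_{N-1}` of `ℝ^N`. -/
noncomputable def rowForm {N : ℕ} (k : ℕ) (a : ℕ → ℝ) (v : Fin N → EuclideanSpace ℝ (Fin N))
    (j : Fin N) : ℝ :=
  ∑ i ∈ Finset.univ.filter (fun i : Fin N => (i : ℕ) < k), a i * (v i j) ^ 2

/-- The rescaled Gram–Schmidt orthonormalizations `√N γ_i`, where
`w_i = y_i - ∑_{l < i} (⟪y_i, w_l⟫ / ‖w_l‖²) w_l` and `γ_i = w_i / ‖w_i‖`. -/
noncomputable def rescaledGramSchmidt {N : ℕ} (y : Fin N → EuclideanSpace ℝ (Fin N)) :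
    Fin N → EuclideanSpace ℝ (Fin N) :=
  fun i => √(N : ℝ) • InnerProductSpace.gramSchmidtNormed ℝ y i

/-!
Write `w i` for the Gram–Schmidt vectors, `γ i = w i / ‖w i‖`, and `Δ i = y i - w i` for the
projection of `y i` on the span of the earlier vectors. With `K = k N`, the two quadratic forms at
column `j` differ by (`rowForm_sub_eq`)

  `∑ a i (N / ‖w i‖² - 1) (w i j)² - 2 ∑ a i (w i j) (Δ i j) - ∑ a i (Δ i j)²`,

and it suffices to show that this is small uniformly in `j`, with high probability.

* Since `‖w i‖² = ‖y i‖² - ‖Δ i‖²`, Markov's inequality with `E |‖y i‖² - N| = O(√N)` and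
  `E ‖Δ i‖² ≤ K` shows that `∑ |N - ‖w i‖²|` is of order `K √N + K²`, which is what the first sum
  needs. In particular `‖w i‖² ≥ N / 2`.
* Let `e j` be the `j`-th basis vector and `u i j` its projection on the span of the earlier
  vectors. Then `Δ i j = ⟪u i j, y i⟫` and `w i j = ⟪e j - u i j, y i⟫`, where the directions are
  orthogonal and determined by the earlier vectors. So, given these, `Δ i j` is a Gaussian of
  variance `‖u i j‖² = ∑ l < i, (γ l j)²`, of order `K / N`, and it is independent of `w i j`. This
  bounds the last sum by order `K² / N`.
* For the same reason the products of
  `exp (b i Δ i j - b i² ‖u i j‖² / 2)`, with `b i` proportional to `a i (w i j)`, have mean at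
  most `1` (`lintegral_pi_prod_le_one`). Hence the cross sum has a sub-Gaussian tail with variance
  proxy `∑ (a i w i j)² ‖u i j‖²`, of order `K² / N` (`measure_pi_stdGaussian_tail`). A termwise
  bound would only give `K ^ (3 / 2) / √N`, which need not be small.

All tails are strong enough for a union bound over `i` and `j` when the slack is a factor
`M = N ^ (δ / 4)`: the final error is of order `K M³ / √N = O(N ^ (-δ / 4))`.
-/

/-! ### Exponential moments of predictable Gaussian transforms -/

open Function in
/-- Resampling one coordinate independently does not change the mean. -/
lemma lintegral_pi_lintegral_update {ι : Type*} [Fintype ι] [DecidableEq ι] {X : ι → Type*}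
    [∀ i, MeasurableSpace (X i)] (μ : ∀ i, Measure (X i)) [∀ i, IsProbabilityMeasure (μ i)]
    (i : ι) {f : (∀ i, X i) → ENNReal} (hf : Measurable f) :
    ∫⁻ y, (∫⁻ x, f (update y i x) ∂μ i) ∂Measure.pi μ = ∫⁻ y, f y ∂Measure.pi μ := by
  have hG : (fun y => ∫⁻ x, f (update y i x) ∂μ i) = ∫⋯∫⁻_{i}, f ∂μ := by
    ext y; rw [lmarginal_singleton]
  have hGm : Measurable (fun y => ∫⁻ x, f (update y i x) ∂μ i) := by
    rw [hG]; exact hf.lmarginal μ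
  refine lintegral_eq_of_lmarginal_eq {i} hGm hf ?_
  rw [lmarginal_singleton, lmarginal_singleton]
  ext y
  simp

open Function in
/-- A product of nonnegative factors, each depending only on the coordinates up to its own index and
having conditional mean at most `1` given the earlier coordinates, has mean at most `1`. -/
lemma lintegral_pi_prod_le_one {ι : Type*} [Fintype ι] [LinearOrder ι] {X : ι → Type*}
    [∀ i, MeasurableSpace (X i)] (μ : ∀ i, Measure (X i)) [∀ i, IsProbabilityMeasure (μ i)]
    {f : ι → (∀ i, X i) → ENNReal} (hf : ∀ i, Measurable (f i))
    (hadapt : ∀ m i, m < i → ∀ y x, f m (update y i x) = f m y)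
    (hint : ∀ i y, ∫⁻ x, f i (update y i x) ∂μ i ≤ 1) (s : Finset ι) :
    ∫⁻ y, ∏ i ∈ s, f i y ∂Measure.pi μ ≤ 1 := by
  induction s using Finset.induction_on_max with
  | empty => simp
  | insert i s hi ih =>
    have hmem : i ∉ s := fun h => lt_irrefl _ (hi i h)
    have hm : Measurable fun y => ∏ j ∈ s, f j y := Finset.measurable_prod _ fun j _ => hf j
    simp_rw [Finset.prod_insert hmem]
    have hmul : Measurable fun y => f i y * ∏ j ∈ s, f j y := (hf i).mul hm
    rw [← lintegral_pi_lintegral_update μ i hmul]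
    refine (lintegral_mono fun y => ?_).trans ih
    have h1 : ∀ x, ∏ j ∈ s, f j (update y i x) = ∏ j ∈ s, f j y := fun x =>
      Finset.prod_congr rfl fun j hj => hadapt j i (hi j hj) y x
    simp only [h1]
    have hfu : Measurable fun x => f i (update y i x) := (hf i).comp (measurable_update y)
    rw [lintegral_mul_const _ hfu]
    exact (mul_le_mul_left (hint i y) _).trans_eq (one_mul _)

section Gaussian

variable {E : Type*} [NormedAddCommGroup E] [InnerProductSpace ℝ E] [FiniteDimensional ℝ E]
  [MeasurableSpace E] [BorelSpace E]

open scoped RealInnerProductSpace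

lemma map_inner_stdGaussian (u : E) :
    (stdGaussian E).map (fun x => ⟪u, x⟫) = gaussianReal 0 (‖u‖ ^ 2).toNNReal := by
  have h := IsGaussian.map_eq_gaussianReal (μ := stdGaussian E) (innerSL ℝ u)
  rw [integral_strongDual_stdGaussian, variance_dual_stdGaussian, innerSL_apply_norm] at h
  exact h

lemma indepFun_inner_stdGaussian {u v : E} (huv : ⟪u, v⟫ = 0) :
    IndepFun (fun x => ⟪v, x⟫) (fun x => ⟪u, x⟫) (stdGaussian E) := by
  refine HasGaussianLaw.indepFun_of_covariance_eq_zero ?_ ?_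
  · exact ⟨IsGaussian.hasGaussianLaw_id.map ((innerSL ℝ v).prod (innerSL ℝ u)) |>.1⟩
  · rw [← covarianceBilin_apply_eq_cov IsGaussian.memLp_two_id, covarianceBilin_stdGaussian]
    rw [real_inner_comm] at huv
    exact huv

/-- For `u ⟂ v` the variables `⟪u, x⟫` and `⟪v, x⟫` are independent, so `⟪u, x⟫` can be integrated
out first, with `b ⟪v, x⟫` as a constant. -/
lemma lintegral_exp_inner_stdGaussian {u v : E} (huv : ⟪u, v⟫ = 0) {b : ℝ → ℝ}
    (hb : Measurable b) :
    ∫⁻ x, ENNReal.ofReal (Real.exp (b ⟪v, x⟫ * ⟪u, x⟫ - b ⟪v, x⟫ ^ 2 * ‖u‖ ^ 2 / 2))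
      ∂stdGaussian E = 1 := by
  have hI := (indepFun_iff_map_prod_eq_prod_map_map (by fun_prop) (by fun_prop)).1
    (indepFun_inner_stdGaussian huv)
  have hm : Measurable fun p : ℝ × ℝ =>
      ENNReal.ofReal (Real.exp (b p.1 * p.2 - b p.1 ^ 2 * ‖u‖ ^ 2 / 2)) := by fun_prop
  have h1 := lintegral_map (μ := stdGaussian E) hm
    (show Measurable fun x : E => (⟪v, x⟫, ⟪u, x⟫) by fun_prop)
  rw [← h1, hI, lintegral_prod _ hm.aemeasurable, map_inner_stdGaussian u]
  have h2 : ∀ s : ℝ, ∫⁻ t, ENNReal.ofReal (Real.exp (b s * t - b s ^ 2 * ‖u‖ ^ 2 / 2))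
      ∂gaussianReal 0 (‖u‖ ^ 2).toNNReal = 1 := by
    intro s
    simp_rw [Real.exp_sub]
    rw [← ofReal_integral_eq_lintegral_ofReal]
    · rw [integral_div]
      have := congrFun (mgf_fun_id_gaussianReal (μ := 0) (v := (‖u‖ ^ 2).toNNReal)) (b s)
      rw [mgf] at this
      rw [this, Real.coe_toNNReal _ (by positivity)]
      rw [← Real.exp_sub]
      simp [mul_comm]
    · exact (integrable_exp_mul_gaussianReal _).div_const _
    · exact .of_forall fun _ => by positivity
  simp only [h2, lintegral_const, one_mul]
  rw [Measure.map_apply (by fun_prop) .univ]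
  simp

open Function in
/-- Sub-Gaussian tail of the transform `∑ i, b i ⟪r i, y i⟫ * ⟪q i, y i⟫` of independent standard
Gaussian vectors `y i`, where the directions `q i ⟂ r i` depend only on the vectors before `y i`:
given these vectors and `⟪r i, y i⟫`, the factor `⟪q i, y i⟫` is still a centred Gaussian of
variance `‖q i‖ ^ 2`. -/
lemma measure_pi_stdGaussian_tail {ι : Type*} [Fintype ι] [LinearOrder ι]
    {q r : ι → (ι → E) → E} (hq : ∀ i, Measurable (q i)) (hr : ∀ i, Measurable (r i))
    (hq' : ∀ m i, m ≤ i → ∀ y x, q m (update y i x) = q m y)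
    (hr' : ∀ m i, m ≤ i → ∀ y x, r m (update y i x) = r m y)
    (hqr : ∀ i y, ⟪q i y, r i y⟫ = 0) {b : ι → ℝ → ℝ} (hb : ∀ i, Measurable (b i))
    {t v : ℝ} (ht : 0 ≤ t) (hv : 0 < v) :
    Measure.pi (fun _ : ι => stdGaussian E)
      {y | t ≤ |∑ i, b i ⟪r i y, y i⟫ * ⟪q i y, y i⟫| ∧
        ∑ i, b i ⟪r i y, y i⟫ ^ 2 * ‖q i y‖ ^ 2 ≤ v} ≤
      2 * ENNReal.ofReal (Real.exp (-(t ^ 2 / (2 * v)))) := by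
  set P := Measure.pi (fun _ : ι => stdGaussian E) with hP
  -- Markov's inequality for the exponential with parameter `c`, used for the optimal `c = ± t / v`
  have key : ∀ c : ℝ, P {y | t / v * t - (t / v) ^ 2 * v / 2 ≤
      ∑ i, (c * b i ⟪r i y, y i⟫ * ⟪q i y, y i⟫
        - (c * b i ⟪r i y, y i⟫) ^ 2 * ‖q i y‖ ^ 2 / 2)} ≤
      ENNReal.ofReal (Real.exp (-(t ^ 2 / (2 * v)))) := by
    intro c
    set f : ι → (ι → E) → ENNReal := fun i y => ENNReal.ofReal (Real.exp
      (c * b i ⟪r i y, y i⟫ * ⟪q i y, y i⟫ - (c * b i ⟪r i y, y i⟫) ^ 2 * ‖q i y‖ ^ 2 / 2)) with hf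
    have hfm : ∀ i, Measurable (f i) := by
      intro i
      have := hb i; have := hq i; have := hr i
      fun_prop
    have h1 : ∫⁻ y, ∏ i, f i y ∂P ≤ 1 := by
      refine lintegral_pi_prod_le_one _ hfm ?_ ?_ Finset.univ
      · intro m i hmi y x
        simp only [hf, hq' m i hmi.le, hr' m i hmi.le, update_of_ne hmi.ne]
      · intro i y
        simp only [hf, hq' i i le_rfl, hr' i i le_rfl, update_self]
        exact (lintegral_exp_inner_stdGaussian (hqr i y) ((hb i).const_mul c)).le
    have h2 := meas_ge_le_lintegral_div (μ := P)
      (f := fun y => ∏ i, f i y) (Finset.measurable_prod _ fun i _ => hfm i).aemeasurable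
      (ε := ENNReal.ofReal (Real.exp (t ^ 2 / (2 * v)))) (by simp [Real.exp_pos])
      ENNReal.ofReal_ne_top
    have h3 : ENNReal.ofReal (Real.exp (-(t ^ 2 / (2 * v)))) =
        1 / ENNReal.ofReal (Real.exp (t ^ 2 / (2 * v))) := by
      rw [Real.exp_neg, one_div, ENNReal.ofReal_inv_of_pos (Real.exp_pos _)]
    rw [h3]
    refine le_trans (measure_mono fun y hy => ?_) (h2.trans (by gcongr))
    simp only [Set.mem_ofPred_eq, hf] at hy ⊢
    rw [← ENNReal.ofReal_prod_of_nonneg (fun i _ => (Real.exp_pos _).le), ← Real.exp_sum]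
    refine ENNReal.ofReal_le_ofReal (Real.exp_le_exp.2 (le_trans (le_of_eq ?_) hy))
    field_simp
    ring
  have hsum : ∀ c : ℝ, ∀ y : ι → E, ∑ i, (c * b i ⟪r i y, y i⟫ * ⟪q i y, y i⟫
        - (c * b i ⟪r i y, y i⟫) ^ 2 * ‖q i y‖ ^ 2 / 2) =
      c * (∑ i, b i ⟪r i y, y i⟫ * ⟪q i y, y i⟫) -
        c ^ 2 * (∑ i, b i ⟪r i y, y i⟫ ^ 2 * ‖q i y‖ ^ 2) / 2 := by
    intro c y
    rw [Finset.sum_sub_distrib, Finset.mul_sum, Finset.mul_sum, Finset.sum_div]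
    congr 1 <;> exact Finset.sum_congr rfl fun i _ => by ring
  have htv : 0 ≤ t / v := by positivity
  rw [two_mul]
  refine le_trans (measure_mono ?_) ((measure_union_le _ _).trans
    (add_le_add (key (t / v)) (key (-(t / v)))))
  rintro y ⟨h1, h2⟩
  simp only [Set.mem_union, Set.mem_ofPred_eq, hsum]
  have h3 := mul_le_mul_of_nonneg_left h2 (sq_nonneg (t / v))
  rcases le_abs.1 h1 with h | h
  · left
    have := mul_le_mul_of_nonneg_left h htv
    linarith
  · right
    have := mul_le_mul_of_nonneg_left h htv
    rw [neg_sq]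
    linarith

end Gaussian

/-! ### Projections in Gram–Schmidt bases -/

section GramSchmidtProjection

open scoped RealInnerProductSpace
open InnerProductSpace Finset

variable {ι : Type*} [Fintype ι] [LinearOrder ι] [LocallyFiniteOrderBot ι]
  {E : Type*} [NormedAddCommGroup E] [InnerProductSpace ℝ E]

/-- The orthogonal projection of `z` onto the span of the vectors `y l`, `l < i`, written in the
Gram–Schmidt basis (a vanishing `gramSchmidtNormed ℝ y l` contributes nothing). -/
noncomputable def gramSchmidtProj (y : ι → E) (i : ι) (z : E) : E :=
  ∑ l ∈ Iio i, ⟪gramSchmidtNormed ℝ y l, z⟫ • gramSchmidtNormed ℝ y l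

lemma inner_gramSchmidtProj (y : ι → E) (i : ι) (z x : E) :
    ⟪gramSchmidtProj y i z, x⟫ =
      ∑ l ∈ Iio i, ⟪gramSchmidtNormed ℝ y l, z⟫ * ⟪gramSchmidtNormed ℝ y l, x⟫ := by
  simp [gramSchmidtProj, sum_inner, real_inner_smul_left]

lemma inner_gramSchmidtProj_comm (y : ι → E) (i : ι) (z x : E) :
    ⟪gramSchmidtProj y i z, x⟫ = ⟪z, gramSchmidtProj y i x⟫ := by
  rw [real_inner_comm _ z, inner_gramSchmidtProj, inner_gramSchmidtProj]
  exact sum_congr rfl fun _ _ => mul_comm _ _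

lemma inner_gramSchmidtNormed_of_ne (y : ι → E) {l m : ι} (h : l ≠ m) :
    ⟪gramSchmidtNormed ℝ y l, gramSchmidtNormed ℝ y m⟫ = 0 := by
  simp [gramSchmidtNormed, real_inner_smul_left, real_inner_smul_right,
    gramSchmidt_orthogonal ℝ y h]

lemma inner_gramSchmidtNormed_proj (y : ι → E) {l i : ι} (h : l < i) (z : E) :
    ⟪gramSchmidtNormed ℝ y l, gramSchmidtProj y i z⟫ = ⟪gramSchmidtNormed ℝ y l, z⟫ := by
  rw [real_inner_comm, inner_gramSchmidtProj, sum_eq_single_of_mem l (mem_Iio.2 h)]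
  · by_cases h0 : gramSchmidtNormed ℝ y l = 0
    · simp [h0]
    · rw [real_inner_self_eq_norm_sq, gramSchmidtNormed_unit_length' h0]; ring
  · intro m _ hm
    rw [inner_gramSchmidtNormed_of_ne y hm, mul_zero]

lemma norm_sq_gramSchmidtProj (y : ι → E) (i : ι) (z : E) :
    ‖gramSchmidtProj y i z‖ ^ 2 = ∑ l ∈ Iio i, ⟪gramSchmidtNormed ℝ y l, z⟫ ^ 2 := by
  rw [← real_inner_self_eq_norm_sq, inner_gramSchmidtProj]
  refine sum_congr rfl fun l hl => ?_
  rw [inner_gramSchmidtNormed_proj y (mem_Iio.1 hl), sq]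

lemma inner_gramSchmidtProj_self (y : ι → E) (i : ι) (z : E) :
    ⟪gramSchmidtProj y i z, z⟫ = ‖gramSchmidtProj y i z‖ ^ 2 := by
  rw [norm_sq_gramSchmidtProj, inner_gramSchmidtProj]
  exact sum_congr rfl fun _ _ => (sq _).symm

lemma inner_gramSchmidtProj_sub (y : ι → E) (i : ι) (z : E) :
    ⟪gramSchmidtProj y i z, z - gramSchmidtProj y i z⟫ = 0 := by
  rw [inner_sub_right, inner_gramSchmidtProj_self, real_inner_self_eq_norm_sq, sub_self]

lemma norm_sq_sub_gramSchmidtProj (y : ι → E) (i : ι) (z : E) :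
    ‖z - gramSchmidtProj y i z‖ ^ 2 = ‖z‖ ^ 2 - ‖gramSchmidtProj y i z‖ ^ 2 := by
  rw [norm_sub_sq_real, real_inner_comm, inner_gramSchmidtProj_self]
  ring

lemma gramSchmidt_eq_sub_proj (y : ι → E) (i : ι) :
    gramSchmidt ℝ y i = y i - gramSchmidtProj y i (y i) := by
  rw [gramSchmidt_def, gramSchmidtProj]
  congr 1
  refine sum_congr rfl fun l _ => ?_
  rw [Submodule.starProjection_singleton, gramSchmidtNormed, real_inner_smul_left, smul_smul]
  congr 1
  simp only [RCLike.ofReal_real_eq_id, id]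
  rw [div_eq_mul_inv, sq, mul_inv]
  ring



lemma gramSchmidt_update_of_lt (y : ι → E) (i : ι) (x : E) {m : ι} (hm : m < i) :
    gramSchmidt ℝ (Function.update y i x) m = gramSchmidt ℝ y m := by
  induction m using WellFoundedLT.induction with
  | ind m ih =>
    rw [gramSchmidt_def, gramSchmidt_def, Function.update_of_ne hm.ne]
    congr 1
    refine sum_congr rfl fun l hl => ?_
    rw [ih l (mem_Iio.1 hl) ((mem_Iio.1 hl).trans hm)]

lemma gramSchmidtProj_update_of_le (y : ι → E) (i : ι) (x : E) {m : ι} (hm : m ≤ i) (z : E) :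
    gramSchmidtProj (Function.update y i x) m z = gramSchmidtProj y m z := by
  refine sum_congr rfl fun l hl => ?_
  simp only [gramSchmidtNormed, gramSchmidt_update_of_lt y i x ((mem_Iio.1 hl).trans_le hm)]

variable [MeasurableSpace E] [BorelSpace E] [FiniteDimensional ℝ E]

lemma measurable_gramSchmidt (i : ι) :
    Measurable fun y : ι → E => gramSchmidt ℝ y i := by
  induction i using WellFoundedLT.induction with
  | ind i ih =>
    simp only [gramSchmidt_def ℝ _ i, Submodule.starProjection_singleton]
    refine (measurable_pi_apply i).sub (Finset.measurable_sum _ fun l hl => ?_)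
    have := ih l (mem_Iio.1 hl)
    simp only [RCLike.ofReal_real_eq_id, id]
    fun_prop

lemma measurable_gramSchmidtNormed (i : ι) :
    Measurable fun y : ι → E => gramSchmidtNormed ℝ y i := by
  have := measurable_gramSchmidt (E := E) i
  simp only [gramSchmidtNormed, RCLike.ofReal_real_eq_id, id]
  fun_prop

lemma measurable_gramSchmidtProj (i : ι) (z : E) :
    Measurable fun y : ι → E => gramSchmidtProj y i z := by
  refine Finset.measurable_sum _ fun l _ => ?_
  have := measurable_gramSchmidtNormed (E := E) l
  fun_prop

lemma measurable_gramSchmidtProj_self (i : ι) :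
    Measurable fun y : ι → E => gramSchmidtProj y i (y i) := by
  refine Finset.measurable_sum _ fun l _ => ?_
  have := measurable_gramSchmidtNormed (E := E) l
  fun_prop

end GramSchmidtProjection

/-! ### Second moments of standard Gaussian vectors -/

section Moments

open scoped RealInnerProductSpace
open InnerProductSpace Finset

lemma lintegral_inner_sq_stdGaussian {E : Type*} [NormedAddCommGroup E] [InnerProductSpace ℝ E]
    [FiniteDimensional ℝ E] [MeasurableSpace E] [BorelSpace E] (u : E) :
    ∫⁻ x, ENNReal.ofReal (⟪u, x⟫ ^ 2) ∂stdGaussian E = ENNReal.ofReal (‖u‖ ^ 2) := by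
  have hL : MemLp (innerSL ℝ u) 2 (stdGaussian E) :=
    (innerSL ℝ u).comp_memLp' IsGaussian.memLp_two_id
  have h := variance_dual_stdGaussian (innerSL ℝ u)
  rw [innerSL_apply_norm, variance_of_integral_eq_zero hL.aemeasurable
    (integral_strongDual_stdGaussian _)] at h
  rw [← h, ofReal_integral_eq_lintegral_ofReal hL.integrable_sq
    (.of_forall fun _ => by positivity)]
  rfl

/-- The squared norm of a standard Gaussian vector in `ℝ^N` is within `O(√N)` of `N` on average,
as a sum of `N` independent variables of mean `1` and equal finite variance. -/
lemma exists_lintegral_norm_sq_sub_le : ∃ c : ℝ, 0 ≤ c ∧ ∀ N : ℕ,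
    ∫⁻ x, ENNReal.ofReal |‖x‖ ^ 2 - N| ∂stdGaussian (EuclideanSpace ℝ (Fin N)) ≤
      ENNReal.ofReal (c * √N) := by
  set c := Var[fun x : ℝ => x ^ 2; gaussianReal 0 1] with hc
  refine ⟨√c, Real.sqrt_nonneg _, fun N => ?_⟩
  have h4 : MemLp (fun x : ℝ => x ^ 2) 2 (gaussianReal 0 1) := by
    rw [memLp_two_iff_integrable_sq (by fun_prop)]
    have h := (memLp_id_gaussianReal (μ := 0) (v := 1) 4).integrable_norm_pow (p := 4) (by simp)
    refine h.congr (.of_forall fun x => ?_)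
    simp only [id, Real.norm_eq_abs]
    rw [← pow_mul, Even.pow_abs (by decide)]
  have hm1 : ∫ x : ℝ, x ^ 2 ∂gaussianReal 0 1 = 1 := by
    have := variance_id_gaussianReal (μ := 0) (v := 1)
    rw [variance_of_integral_eq_zero (by fun_prop) (by simp)] at this
    simpa using this
  set Q := Measure.pi fun _ : Fin N => gaussianReal 0 1 with hQ
  have hev : ∀ i : Fin N, MemLp (fun x : Fin N → ℝ => x i ^ 2) 2 Q := fun i =>
    h4.comp_measurePreserving (measurePreserving_eval _ i)
  have hS : MemLp (fun x : Fin N → ℝ => ∑ i, x i ^ 2) 2 Q := memLp_finsetSum _ fun i _ => hev i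
  have hmean : ∫ x, ∑ i, x i ^ 2 ∂Q = N := by
    rw [integral_finsetSum _ fun i _ => (hev i).integrable one_le_two]
    have : ∀ i : Fin N, ∫ x, x i ^ 2 ∂Q = 1 := fun i =>
      (integral_comp_eval (μ := fun _ : Fin N => gaussianReal 0 1) (f := fun x : ℝ => x ^ 2)
        (by fun_prop)).trans hm1
    simp [this]
  have hvar : Var[fun x : Fin N → ℝ => ∑ i, x i ^ 2; Q] = N * c := by
    have := variance_sum_pi (μ := fun _ : Fin N => gaussianReal 0 1)
      (X := fun _ (x : ℝ) => x ^ 2) (fun _ => h4)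
    simp only [sum_const, card_univ, Fintype.card_fin, nsmul_eq_mul] at this
    rw [← this]
    congr 1
    ext x
    simp
  rw [← map_pi_eq_stdGaussian, lintegral_map (by fun_prop) (by fun_prop)]
  have hint : Integrable (fun x : Fin N → ℝ => |∑ i, x i ^ 2 - (N : ℝ)|) Q :=
    ((hS.integrable one_le_two).sub (integrable_const _)).abs
  have hle : ∫ x, |∑ i, x i ^ 2 - (N : ℝ)| ∂Q ≤ √c * √N := by
    rw [← Real.sqrt_mul (variance_nonneg _ _), mul_comm, ← hvar]
    refine Real.le_sqrt_of_sq_le ?_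
    have hd : MemLp (fun x : Fin N → ℝ => |∑ i, x i ^ 2 - (N : ℝ)|) 2 Q :=
      (hS.sub (memLp_const (N : ℝ))).abs
    have h0 := variance_nonneg (fun x : Fin N → ℝ => |∑ i, x i ^ 2 - (N : ℝ)|) Q
    rw [variance_eq_sub hd] at h0
    rw [variance_eq_integral hS.aemeasurable, hmean]
    simp only [Pi.pow_apply, sq_abs] at h0
    linarith
  have h5 : ∀ x : Fin N → ℝ, ‖WithLp.toLp 2 x‖ ^ 2 = ∑ i, x i ^ 2 := fun x => by
    rw [EuclideanSpace.real_norm_sq_eq]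
  simp_rw [h5]
  rw [← ofReal_integral_eq_lintegral_ofReal hint (.of_forall fun _ => abs_nonneg _)]
  exact ENNReal.ofReal_le_ofReal hle

end Moments

/-! ### Comparison of the quadratic forms under typical bounds -/

section Deterministic

open scoped RealInnerProductSpace
open InnerProductSpace Finset

lemma inner_sub_gramSchmidtProj_single {N : ℕ} (y : Fin N → EuclideanSpace ℝ (Fin N))
    (i j : Fin N) :
    ⟪EuclideanSpace.single j (1 : ℝ) - gramSchmidtProj y i (EuclideanSpace.single j 1), y i⟫ =
      gramSchmidt ℝ y i j := by
  rw [inner_sub_left, inner_gramSchmidtProj_comm, ← inner_sub_right, ← gramSchmidt_eq_sub_proj]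
  simp [EuclideanSpace.inner_single_left]

lemma gramSchmidt_apply_add_inner {N : ℕ} (y : Fin N → EuclideanSpace ℝ (Fin N)) (i j : Fin N) :
    y i j = gramSchmidt ℝ y i j +
      ⟪gramSchmidtProj y i (EuclideanSpace.single j (1 : ℝ)), y i⟫ := by
  rw [← inner_sub_gramSchmidtProj_single, inner_sub_left]
  simp [EuclideanSpace.inner_single_left]

lemma norm_sq_gramSchmidt {N : ℕ} (y : Fin N → EuclideanSpace ℝ (Fin N)) (i : Fin N) :
    ‖gramSchmidt ℝ y i‖ ^ 2 = ‖y i‖ ^ 2 - ‖gramSchmidtProj y i (y i)‖ ^ 2 := by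
  rw [gramSchmidt_eq_sub_proj, norm_sq_sub_gramSchmidtProj]

lemma card_filter_val_lt_le (N K : ℕ) : #{i : Fin N | (i : ℕ) < K} ≤ K := by
  refine (card_le_card_of_injOn (t := range K) (fun i : Fin N => (i : ℕ)) ?_ ?_).trans_eq
    (card_range K)
  · intro i hi
    simpa using hi
  · exact fun i _ j _ h => Fin.ext h

/-- The expansion `y i j = w i j + Δ i j` of an entry into its Gram–Schmidt part and its projection
on the earlier vectors turns the difference of the two quadratic forms into a normalisation error,
a cross term and a square term. -/
lemma rowForm_sub_eq {N : ℕ} (K : ℕ) (a : ℕ → ℝ) (y : Fin N → EuclideanSpace ℝ (Fin N))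
    (j : Fin N) :
    rowForm K a (rescaledGramSchmidt y) j - rowForm K a y j =
      (∑ i : Fin N with i.val < K,
        a i * ((N : ℝ) * (‖gramSchmidt ℝ y i‖ ^ 2)⁻¹ - 1) * gramSchmidt ℝ y i j ^ 2)
      - 2 * (∑ i : Fin N with i.val < K, a i * gramSchmidt ℝ y i j *
          ⟪gramSchmidtProj y i (EuclideanSpace.single j (1 : ℝ)), y i⟫)
      - ∑ i : Fin N with i.val < K,
          a i * ⟪gramSchmidtProj y i (EuclideanSpace.single j (1 : ℝ)), y i⟫ ^ 2 := by
  rw [rowForm, rowForm, mul_sum, ← sum_sub_distrib, ← sum_sub_distrib, ← sum_sub_distrib]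
  refine sum_congr rfl fun i _ => ?_
  rw [gramSchmidt_apply_add_inner y i j]
  simp only [rescaledGramSchmidt, gramSchmidtNormed, PiLp.smul_apply, smul_eq_mul,
    RCLike.ofReal_real_eq_id, id]
  rw [mul_pow, Real.sq_sqrt (Nat.cast_nonneg N), mul_pow, inv_pow]
  ring

/-- Deterministic comparison of the two quadratic forms. Here `M` is a slowly growing bound and
`K * M ^ 3 / √N` is small; the hypotheses are those typical bounds which hold with high probability
for Gaussian vectors. In the last two, a Gaussian quantity is controlled only under a bound on its
conditional variance, which the other hypotheses provide. -/
lemma abs_rowForm_sub_le {N : ℕ} (hN : 0 < N) {K : ℕ} {a : ℕ → ℝ} {A : ℝ} (hA : 0 ≤ A)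
    (ha : ∀ i < K, |a i| ≤ A) {M : ℝ} (hM : 1 ≤ M) (hr : K * M ^ 3 / √N ≤ 1 / 4)
    {y : Fin N → EuclideanSpace ℝ (Fin N)}
    (hw : ∀ i j : Fin N, |gramSchmidt ℝ y i j| ≤ M)
    (hnorm : ∑ i : Fin N with i.val < K, |‖y i‖ ^ 2 - N| ≤ M * (K * √N))
    (hproj : ∑ i : Fin N with i.val < K, ‖gramSchmidtProj y i (y i)‖ ^ 2 ≤ M * (K * K))
    (hΔ : ∀ i j : Fin N,
      ‖gramSchmidtProj y i (EuclideanSpace.single j (1 : ℝ))‖ ^ 2 ≤ 2 * K * M ^ 2 / N →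
      |⟪gramSchmidtProj y i (EuclideanSpace.single j (1 : ℝ)), y i⟫| ≤
        M * √(2 * K * M ^ 2 / N))
    (hS : ∀ j : Fin N,
      ∑ i : Fin N with i.val < K, (a i * gramSchmidt ℝ y i j) ^ 2 *
        ‖gramSchmidtProj y i (EuclideanSpace.single j (1 : ℝ))‖ ^ 2 ≤
          2 * (K * A * M ^ 2) ^ 2 / N →
      |∑ i : Fin N with i.val < K, a i * gramSchmidt ℝ y i j *
        ⟪gramSchmidtProj y i (EuclideanSpace.single j (1 : ℝ)), y i⟫| ≤
          2 * A * (K * M ^ 3 / √N)) (j : Fin N) :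
    |rowForm K a (rescaledGramSchmidt y) j - rowForm K a y j| ≤
      10 * A * (K * M ^ 3 / √N) := by
  set r : ℝ := K * M ^ 3 / √N with hrdef
  have hNpos : (0 : ℝ) < N := by exact_mod_cast hN
  have hsN : 0 < √(N : ℝ) := Real.sqrt_pos.2 hNpos
  have hsq : √(N : ℝ) ^ 2 = N := Real.sq_sqrt hNpos.le
  have hM0 : 0 < M := by linarith
  have hK0 : (0 : ℝ) ≤ K := Nat.cast_nonneg K
  have hr0 : 0 ≤ r := by positivity
  have hrmul : r * √N = K * M ^ 3 := by rw [hrdef]; field_simp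
  have hr2 : r ^ 2 * N = K ^ 2 * M ^ 6 := by
    rw [← hsq, ← mul_pow, hrmul]; ring
  have hrr : r ^ 2 ≤ r / 4 := by nlinarith
  have hcard : ((#{i : Fin N | (i : ℕ) < K} : ℕ) : ℝ) ≤ K := by
    exact_mod_cast card_filter_val_lt_le N K
  have mem : ∀ {i : Fin N}, i ∈ ({i : Fin N | (i : ℕ) < K} : Finset (Fin N)) ↔ (i : ℕ) < K := by
    simp
  have hdev : ∑ i : Fin N with i.val < K, |(N : ℝ) - ‖gramSchmidt ℝ y i‖ ^ 2| ≤
      M * (K * √N) + M * (K * K) := by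
    refine le_trans ?_ (add_le_add hnorm hproj)
    rw [← sum_add_distrib]
    refine sum_le_sum fun i _ => ?_
    rw [norm_sq_gramSchmidt, show (N : ℝ) - (‖y i‖ ^ 2 - ‖gramSchmidtProj y i (y i)‖ ^ 2) =
      -(‖y i‖ ^ 2 - N) + ‖gramSchmidtProj y i (y i)‖ ^ 2 by ring]
    refine (abs_add_le _ _).trans ?_
    rw [abs_neg, abs_of_nonneg (sq_nonneg ‖gramSchmidtProj y i (y i)‖)]
  have hdev2 : M ^ 2 * (M * (K * √N) + M * (K * K)) ≤ (r + r ^ 2) * N := by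
    have h1 : M ^ 2 * (M * (K * √N)) = r * N := by
      linear_combination (-√(N : ℝ)) * hrmul + r * hsq
    have h2 : M ^ 2 * (M * (K * K)) ≤ r ^ 2 * N := by
      rw [hr2]
      have : M ^ 3 ≤ M ^ 6 := pow_le_pow_right₀ hM (by norm_num)
      nlinarith [mul_le_mul_of_nonneg_left this (sq_nonneg (K : ℝ))]
    linarith
  have hw2 : ∀ i : Fin N, (i : ℕ) < K → (N : ℝ) / 2 ≤ ‖gramSchmidt ℝ y i‖ ^ 2 := by
    intro i hi
    have h1 : |(N : ℝ) - ‖gramSchmidt ℝ y i‖ ^ 2| ≤ M * (K * √N) + M * (K * K) :=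
      le_trans (single_le_sum (f := fun i : Fin N => |(N : ℝ) - ‖gramSchmidt ℝ y i‖ ^ 2|)
        (fun i _ => abs_nonneg _) (mem.2 hi)) hdev
    have h2 : M * (K * √N) + M * (K * K) ≤ M ^ 2 * (M * (K * √N) + M * (K * K)) :=
      le_mul_of_one_le_left (by positivity) (one_le_pow₀ hM)
    have h3 := le_abs_self ((N : ℝ) - ‖gramSchmidt ℝ y i‖ ^ 2)
    nlinarith
  have hwsq : ∀ i : Fin N, gramSchmidt ℝ y i j ^ 2 ≤ M ^ 2 := fun i => by
    rw [← sq_abs]; exact pow_le_pow_left₀ (abs_nonneg _) (hw i j) 2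
  have hs2 : ∀ i : Fin N, (i : ℕ) < K →
      ‖gramSchmidtProj y i (EuclideanSpace.single j (1 : ℝ))‖ ^ 2 ≤ 2 * K * M ^ 2 / N := by
    intro i hi
    rw [norm_sq_gramSchmidtProj]
    have hb : ∀ l ∈ Iio i, ⟪gramSchmidtNormed ℝ y l, EuclideanSpace.single j (1 : ℝ)⟫ ^ 2 ≤
        M ^ 2 / (N / 2) := by
      intro l hl
      have hlK : (l : ℕ) < K := lt_trans (Fin.lt_def.1 (mem_Iio.1 hl)) hi
      have : ⟪gramSchmidtNormed ℝ y l, EuclideanSpace.single j (1 : ℝ)⟫ ^ 2 =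
          gramSchmidt ℝ y l j ^ 2 / ‖gramSchmidt ℝ y l‖ ^ 2 := by
        simp only [gramSchmidtNormed, EuclideanSpace.inner_single_right,
          RCLike.ofReal_real_eq_id, id]
        simp
        ring
      rw [this]
      exact div_le_div₀ (by positivity) (hwsq l) (by positivity) (hw2 l hlK)
    refine (sum_le_card_nsmul _ _ _ hb).trans ?_
    rw [Fin.card_Iio, nsmul_eq_mul]
    have : ((i : ℕ) : ℝ) ≤ K := by exact_mod_cast hi.le
    calc ((i : ℕ) : ℝ) * (M ^ 2 / (N / 2)) ≤ K * (M ^ 2 / (N / 2)) := by gcongr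
      _ = 2 * K * M ^ 2 / N := by field_simp
  have haw : ∀ i : Fin N, (i : ℕ) < K → (a i) ^ 2 ≤ A ^ 2 := fun i hi => by
    rw [← sq_abs]; exact pow_le_pow_left₀ (abs_nonneg _) (ha i hi) 2
  have hV : ∑ i : Fin N with i.val < K, (a i * gramSchmidt ℝ y i j) ^ 2 *
        ‖gramSchmidtProj y i (EuclideanSpace.single j (1 : ℝ))‖ ^ 2 ≤
          2 * (K * A * M ^ 2) ^ 2 / N := by
    refine (sum_le_card_nsmul _ _ (A ^ 2 * M ^ 2 * (2 * K * M ^ 2 / N)) fun i hi => ?_).trans ?_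
    · rw [mul_pow]
      exact mul_le_mul (mul_le_mul (haw i (mem.1 hi)) (hwsq i) (sq_nonneg _) (sq_nonneg _))
        (hs2 i (mem.1 hi)) (sq_nonneg _) (by positivity)
    · rw [nsmul_eq_mul]
      refine (mul_le_mul_of_nonneg_right hcard (by positivity)).trans_eq ?_
      field_simp
  have hcross := hS j hV
  have hnormal : |∑ i : Fin N with i.val < K,
      a i * ((N : ℝ) * (‖gramSchmidt ℝ y i‖ ^ 2)⁻¹ - 1) * gramSchmidt ℝ y i j ^ 2| ≤
        2 * A * (r + r ^ 2) := by
    refine (abs_sum_le_sum_abs _ _).trans ?_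
    have hb : ∀ i ∈ ({i : Fin N | (i : ℕ) < K} : Finset (Fin N)),
        |a i * ((N : ℝ) * (‖gramSchmidt ℝ y i‖ ^ 2)⁻¹ - 1) * gramSchmidt ℝ y i j ^ 2| ≤
          A * (|(N : ℝ) - ‖gramSchmidt ℝ y i‖ ^ 2| * (2 / N)) * M ^ 2 := by
      intro i hi
      have h1 := hw2 i (mem.1 hi)
      have hpos : 0 < ‖gramSchmidt ℝ y i‖ ^ 2 := lt_of_lt_of_le (by positivity) h1
      rw [abs_mul, abs_mul, abs_of_nonneg (sq_nonneg (gramSchmidt ℝ y i j))]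
      refine mul_le_mul (mul_le_mul (ha i (mem.1 hi)) ?_ (abs_nonneg _) hA) (hwsq i)
        (sq_nonneg _) (by positivity)
      rw [show (N : ℝ) * (‖gramSchmidt ℝ y i‖ ^ 2)⁻¹ - 1 =
        (N - ‖gramSchmidt ℝ y i‖ ^ 2) * (‖gramSchmidt ℝ y i‖ ^ 2)⁻¹ by
        rw [sub_mul, mul_inv_cancel₀ hpos.ne'],
        abs_mul, abs_of_pos (inv_pos.2 hpos)]
      refine mul_le_mul_of_nonneg_left ?_ (abs_nonneg _)
      rw [show (2 : ℝ) / N = (N / 2 : ℝ)⁻¹ by field_simp]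
      exact inv_anti₀ (by positivity) h1
    refine (sum_le_sum hb).trans ?_
    rw [← sum_mul, ← mul_sum, ← sum_mul]
    calc A * ((∑ i : Fin N with i.val < K, |(N : ℝ) - ‖gramSchmidt ℝ y i‖ ^ 2|) * (2 / N)) * M ^ 2
        ≤ A * ((M * (K * √N) + M * (K * K)) * (2 / N)) * M ^ 2 := by gcongr
      _ = A * (2 / N) * (M ^ 2 * (M * (K * √N) + M * (K * K))) := by ring
      _ ≤ A * (2 / N) * ((r + r ^ 2) * N) := by gcongr
      _ = 2 * A * (r + r ^ 2) := by field_simp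
  have hsquare : |∑ i : Fin N with i.val < K,
          a i * ⟪gramSchmidtProj y i (EuclideanSpace.single j (1 : ℝ)), y i⟫ ^ 2| ≤
        2 * A * r ^ 2 := by
    refine (abs_sum_le_sum_abs _ _).trans ?_
    refine (sum_le_card_nsmul _ _ (A * (M ^ 2 * (2 * K * M ^ 2 / N))) fun i hi => ?_).trans ?_
    · have h1 := hΔ i j (hs2 i (mem.1 hi))
      rw [abs_mul, abs_of_nonneg (sq_nonneg ⟪_, y i⟫)]
      refine mul_le_mul (ha i (mem.1 hi)) ?_ (sq_nonneg _) hA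
      rw [← sq_abs]
      refine (pow_le_pow_left₀ (abs_nonneg _) h1 2).trans_eq ?_
      rw [mul_pow, Real.sq_sqrt (by positivity)]
    · rw [nsmul_eq_mul]
      refine (mul_le_mul_of_nonneg_right hcard (by positivity)).trans ?_
      have h1 : r ^ 2 = K ^ 2 * M ^ 6 / N := by rw [← hr2]; field_simp
      have h2 : M ^ 4 ≤ M ^ 6 := pow_le_pow_right₀ hM (by norm_num)
      calc (K : ℝ) * (A * (M ^ 2 * (2 * K * M ^ 2 / N))) = 2 * A * (K ^ 2 * M ^ 4 / N) := by ring
        _ ≤ 2 * A * (K ^ 2 * M ^ 6 / N) := by gcongr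
        _ = 2 * A * r ^ 2 := by rw [h1]
  rw [rowForm_sub_eq]
  refine (abs_sub _ _).trans ((add_le_add (abs_sub _ _) le_rfl).trans ?_)
  rw [abs_mul, abs_two]
  nlinarith [mul_le_mul_of_nonneg_left hrr hA, mul_nonneg hA hr0]

end Deterministic

/-! ### Probability of the typical bounds -/

section Probability

open scoped RealInnerProductSpace
open InnerProductSpace Finset

open Function in
lemma measure_pi_stdGaussian_inner_tail {E : Type*} [NormedAddCommGroup E] [InnerProductSpace ℝ E]
    [FiniteDimensional ℝ E] [MeasurableSpace E] [BorelSpace E]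
    {ι : Type*} [Fintype ι] [LinearOrder ι] (i : ι) {q : (ι → E) → E} (hq : Measurable q)
    (hq' : ∀ m, i ≤ m → ∀ y x, q (update y m x) = q y) {t v : ℝ} (ht : 0 ≤ t) (hv : 0 < v) :
    Measure.pi (fun _ : ι => stdGaussian E) {y | t ≤ |⟪q y, y i⟫| ∧ ‖q y‖ ^ 2 ≤ v} ≤
      2 * ENNReal.ofReal (Real.exp (-(t ^ 2 / (2 * v)))) := by
  have h := measure_pi_stdGaussian_tail (E := E) (q := fun m y => if m = i then q y else 0)
    (r := fun _ _ => 0) (b := fun _ _ => 1) (fun m => by by_cases hm : m = i <;> simp [hm, hq])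
    (fun _ => measurable_const) (fun m l hml y x => by
      by_cases hm : m = i
      · subst hm; simp [hq' l hml]
      · simp [hm]) (fun _ _ _ _ _ => rfl) (fun _ _ => inner_zero_right _)
    (fun _ => measurable_const) ht hv
  refine le_trans (measure_mono fun y hy => ?_) h
  simp only [Set.mem_ofPred_eq, one_mul, one_pow] at hy ⊢
  rw [sum_eq_single i (by simp +contextual) (by simp),
    sum_eq_single i (by simp +contextual) (by simp), if_pos rfl]
  exact hy

/-- The projection of a standard Gaussian vector on the span of `i` further independent
vectors has mean squared norm at most `i`. -/
lemma lintegral_norm_sq_gramSchmidtProj_le {E : Type*} [NormedAddCommGroup E]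
    [InnerProductSpace ℝ E] [FiniteDimensional ℝ E] [MeasurableSpace E] [BorelSpace E] {N : ℕ}
    (i : Fin N) :
    ∫⁻ y, ENNReal.ofReal (‖gramSchmidtProj y i (y i)‖ ^ 2)
      ∂Measure.pi (fun _ : Fin N => stdGaussian E) ≤ (i : ℕ) := by
  have hm : Measurable fun y : Fin N → E => ENNReal.ofReal (‖gramSchmidtProj y i (y i)‖ ^ 2) := by
    have := measurable_gramSchmidtProj_self (E := E) i
    fun_prop
  rw [← lintegral_pi_lintegral_update _ i hm]
  have h : ∀ y : Fin N → E, ∫⁻ x, ENNReal.ofReal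
      (‖gramSchmidtProj (Function.update y i x) i (Function.update y i x i)‖ ^ 2)
      ∂stdGaussian E ≤ (i : ℕ) := by
    intro y
    simp only [gramSchmidtProj_update_of_le y i _ le_rfl, Function.update_self,
      norm_sq_gramSchmidtProj]
    simp_rw [ENNReal.ofReal_sum_of_nonneg fun _ _ => sq_nonneg _]
    rw [lintegral_finsetSum _ fun l _ => by fun_prop]
    simp only [lintegral_inner_sq_stdGaussian]
    refine (sum_le_card_nsmul _ _ 1 fun l _ => ?_).trans (by simp)
    by_cases h0 : gramSchmidtNormed ℝ y l = 0
    · simp [h0]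
    · simp [gramSchmidtNormed_unit_length' h0]
  refine (lintegral_mono h).trans (by simp)

/-- Markov's inequality for the sum of at most `K` nonnegative variables of mean at most `c' * c`. -/
lemma measure_lt_sum_le {Ω : Type*} [MeasurableSpace Ω] {P : Measure Ω} {N K : ℕ}
    {X : Fin N → Ω → ℝ} (hX : ∀ i, Measurable (X i)) (h0 : ∀ i ω, 0 ≤ X i ω)
    {c M : ℝ} (hc : 0 < c) (hK : 0 < K) (hM : 0 < M) {c' : ℝ}
    (h : ∀ i : Fin N, (i : ℕ) < K → ∫⁻ ω, ENNReal.ofReal (X i ω) ∂P ≤ ENNReal.ofReal (c' * c)) :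
    P {ω | M * (K * c) < ∑ i : Fin N with i.val < K, X i ω} ≤ ENNReal.ofReal (c' / M) := by
  have hpos : 0 < M * (K * c) := by positivity
  have h1 := meas_ge_le_lintegral_div (μ := P)
    (f := fun ω => ENNReal.ofReal (∑ i : Fin N with i.val < K, X i ω))
    (by fun_prop) (ε := ENNReal.ofReal (M * (K * c))) (by simpa using hpos) ENNReal.ofReal_ne_top
  refine (measure_mono fun ω hω => ?_).trans (h1.trans ?_)
  · exact ENNReal.ofReal_le_ofReal (le_of_lt hω)
  · simp_rw [ENNReal.ofReal_sum_of_nonneg fun i _ => h0 i _]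
    rw [lintegral_finsetSum _ fun i _ => by fun_prop]
    have h2 : ∑ i : Fin N with i.val < K, ∫⁻ ω, ENNReal.ofReal (X i ω) ∂P ≤
        ENNReal.ofReal (K * (c' * c)) := by
      refine (sum_le_card_nsmul _ _ _ fun i hi => h i (by simpa using hi)).trans ?_
      rw [nsmul_eq_mul, ENNReal.ofReal_mul (Nat.cast_nonneg K), ENNReal.ofReal_natCast]
      gcongr
      exact card_filter_val_lt_le N K
    refine (ENNReal.div_le_div_right h2 _).trans_eq ?_
    rw [← ENNReal.ofReal_div_of_pos hpos]
    congr 1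
    have : (0 : ℝ) < K := by exact_mod_cast hK
    field_simp

/-- Quantitative comparison of the two quadratic forms for independent standard Gaussian vectors, by
a union bound over the failures of the hypotheses of `abs_rowForm_sub_le`. -/
lemma exists_measure_rowForm_sub_le : ∃ c : ℝ, 0 ≤ c ∧ ∀ (N K : ℕ) (a : ℕ → ℝ) (A M : ℝ), 0 < N →
    0 < K → 0 < A → (∀ i < K, |a i| ≤ A) → 1 ≤ M → K * M ^ 3 / √(N : ℝ) ≤ 1 / 4 →
    Measure.pi (fun _ : Fin N => stdGaussian (EuclideanSpace ℝ (Fin N)))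
      {y | ∃ j, 10 * A * (K * M ^ 3 / √(N : ℝ)) <
        |rowForm K a (rescaledGramSchmidt y) j - rowForm K a y j|} ≤
      ENNReal.ofReal (6 * (N : ℝ) ^ 2 * Real.exp (-(M ^ 2 / 2)) + (c + 1) / M) := by
  obtain ⟨c, hc, hcN⟩ := exists_lintegral_norm_sq_sub_le
  refine ⟨c, hc, fun N K a A M hN hK hA ha hM hr => ?_⟩
  set P := Measure.pi (fun _ : Fin N => stdGaussian (EuclideanSpace ℝ (Fin N))) with hP
  set e : Fin N → EuclideanSpace ℝ (Fin N) := fun j => EuclideanSpace.single j (1 : ℝ) with he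
  have hNpos : (0 : ℝ) < N := by exact_mod_cast hN
  have hKpos : (0 : ℝ) < K := by exact_mod_cast hK
  have hM0 : 0 < M := by linarith
  have hsN : 0 < √(N : ℝ) := Real.sqrt_pos.2 hNpos
  have hsq : √(N : ℝ) ^ 2 = N := Real.sq_sqrt hNpos.le
  set p : ENNReal := 2 * ENNReal.ofReal (Real.exp (-(M ^ 2 / 2))) with hp
  have hmP : ∀ i j, Measurable fun y : Fin N → EuclideanSpace ℝ (Fin N) =>
      gramSchmidtProj y i (e j) := fun i j => measurable_gramSchmidtProj i _
  have b1 : ∀ i j, P {y | M < |gramSchmidt ℝ y i j|} ≤ p := by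
    intro i j
    refine le_trans (measure_mono ?_) ((measure_pi_stdGaussian_inner_tail i
      (q := fun y => e j - gramSchmidtProj y i (e j)) ((hmP i j).const_sub _)
      (fun m hm y x => by rw [gramSchmidtProj_update_of_le y m x hm]) hM0.le
      one_pos).trans_eq (by rw [hp, mul_one]))
    intro y hy
    refine ⟨?_, ?_⟩
    · rw [inner_sub_gramSchmidtProj_single]
      exact le_of_lt hy
    · rw [norm_sq_sub_gramSchmidtProj]
      simp [he]
  have b2 : ∀ i j, P {y | ‖gramSchmidtProj y i (e j)‖ ^ 2 ≤ 2 * K * M ^ 2 / N ∧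
      M * √(2 * K * M ^ 2 / N) < |⟪gramSchmidtProj y i (e j), y i⟫|} ≤ p := by
    intro i j
    have hv : (0 : ℝ) < 2 * K * M ^ 2 / N := by positivity
    refine le_trans (measure_mono ?_) ((measure_pi_stdGaussian_inner_tail i
      (q := fun y => gramSchmidtProj y i (e j)) (hmP i j)
      (fun m hm y x => by rw [gramSchmidtProj_update_of_le y m x hm])
      (t := M * √(2 * K * M ^ 2 / N)) (by positivity) hv).trans_eq ?_)
    · exact fun y hy => ⟨hy.2.le, hy.1⟩
    · rw [mul_pow, Real.sq_sqrt hv.le, mul_comm 2 (2 * K * M ^ 2 / N : ℝ), mul_comm (M ^ 2),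
        mul_div_mul_left _ _ hv.ne']
  have b3 : ∀ j, P {y | ∑ i : Fin N with i.val < K, (a i * gramSchmidt ℝ y i j) ^ 2 *
        ‖gramSchmidtProj y i (e j)‖ ^ 2 ≤ 2 * (K * A * M ^ 2) ^ 2 / N ∧
      2 * A * (K * M ^ 3 / √N) < |∑ i : Fin N with i.val < K, a i * gramSchmidt ℝ y i j *
        ⟪gramSchmidtProj y i (e j), y i⟫|} ≤ p := by
    intro j
    have hv : (0 : ℝ) < 2 * (K * A * M ^ 2) ^ 2 / N := by positivity
    have h := measure_pi_stdGaussian_tail (E := EuclideanSpace ℝ (Fin N))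
      (q := fun i y => gramSchmidtProj y i (e j))
      (r := fun i y => e j - gramSchmidtProj y i (e j))
      (b := fun i s => if i.val < K then a i * s else 0)
      (fun i => hmP i j) (fun i => (hmP i j).const_sub _)
      (fun m i hmi y x => gramSchmidtProj_update_of_le y i x hmi _)
      (fun m i hmi y x => by rw [gramSchmidtProj_update_of_le y i x hmi])
      (fun i y => inner_gramSchmidtProj_sub y i _)
      (fun i => by split_ifs <;> fun_prop)
      (t := 2 * A * (K * M ^ 3 / √N)) (by positivity) hv
    refine le_trans (measure_mono ?_) (h.trans ?_)
    · rintro y ⟨h1, h2⟩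
      simp only [Set.mem_ofPred_eq, he, inner_sub_gramSchmidtProj_single]
      simp only [ite_mul, zero_mul, ite_pow, zero_pow two_ne_zero, ← sum_filter]
      exact ⟨h2.le, h1⟩
    · have : (2 * A * (K * M ^ 3 / √(N : ℝ))) ^ 2 / (2 * (2 * (K * A * M ^ 2) ^ 2 / N)) = M ^ 2 := by
        rw [mul_pow, div_pow, hsq]; field_simp
      rw [this, hp]
      gcongr
      exact half_le_self (sq_nonneg M)
  have b4 : P {y | M * (K * √N) < ∑ i : Fin N with i.val < K, |‖y i‖ ^ 2 - N|} ≤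
      ENNReal.ofReal (c / M) := by
    refine measure_lt_sum_le (P := P) (X := fun i y => |‖y i‖ ^ 2 - N|) (fun i => by fun_prop)
      (fun _ _ => abs_nonneg _) hsN hK hM0 fun i _ => ?_
    have hmp := measurePreserving_eval
      (fun _ : Fin N => stdGaussian (EuclideanSpace ℝ (Fin N))) i
    exact (hmp.lintegral_comp (f := fun x => ENNReal.ofReal |‖x‖ ^ 2 - N|)
      (by fun_prop)).trans_le (hcN N)
  have b5 : P {y | M * (K * K) < ∑ i : Fin N with i.val < K,
      ‖gramSchmidtProj y i (y i)‖ ^ 2} ≤ ENNReal.ofReal (1 / M) := by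
    refine measure_lt_sum_le (P := P) (X := fun i y => ‖gramSchmidtProj y i (y i)‖ ^ 2)
      (fun i => (measurable_gramSchmidtProj_self i).norm.pow_const 2)
      (fun _ _ => sq_nonneg _) hKpos hK hM0 fun i hi => ?_
    refine (lintegral_norm_sq_gramSchmidtProj_le i).trans ?_
    rw [one_mul, ENNReal.ofReal_natCast]
    exact_mod_cast hi.le
  have hsub : {y | ∃ j, 10 * A * (K * M ^ 3 / √(N : ℝ)) <
        |rowForm K a (rescaledGramSchmidt y) j - rowForm K a y j|} ⊆
      (((((⋃ i, ⋃ j, {y | M < |gramSchmidt ℝ y i j|}) ∪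
      (⋃ i, ⋃ j, {y | ‖gramSchmidtProj y i (e j)‖ ^ 2 ≤ 2 * K * M ^ 2 / N ∧
        M * √(2 * K * M ^ 2 / N) < |⟪gramSchmidtProj y i (e j), y i⟫|})) ∪
      (⋃ j, {y | ∑ i : Fin N with i.val < K, (a i * gramSchmidt ℝ y i j) ^ 2 *
          ‖gramSchmidtProj y i (e j)‖ ^ 2 ≤ 2 * (K * A * M ^ 2) ^ 2 / N ∧
        2 * A * (K * M ^ 3 / √N) < |∑ i : Fin N with i.val < K, a i * gramSchmidt ℝ y i j *
          ⟪gramSchmidtProj y i (e j), y i⟫|})) ∪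
      {y | M * (K * √N) < ∑ i : Fin N with i.val < K, |‖y i‖ ^ 2 - N|}) ∪
      {y | M * (K * K) < ∑ i : Fin N with i.val < K, ‖gramSchmidtProj y i (y i)‖ ^ 2}) := by
    rintro y ⟨j, hj⟩
    by_contra hy
    simp only [Set.mem_union, Set.mem_iUnion, Set.mem_ofPred_eq, not_or, not_exists, not_and,
      not_lt] at hy
    obtain ⟨⟨⟨⟨h1, h2⟩, h3⟩, h4⟩, h5⟩ := hy
    exact absurd (abs_rowForm_sub_le hN hA.le ha hM hr h1 h4 h5 h2 h3 j) (not_le.2 hj)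
  have u1 : ∀ {S : Fin N → Set (Fin N → EuclideanSpace ℝ (Fin N))} {p' : ENNReal},
      (∀ j, P (S j) ≤ p') → P (⋃ j, S j) ≤ N * p' := by
    intro S p' h
    refine (measure_iUnion_fintype_le _ _).trans ((sum_le_card_nsmul _ _ _ fun j _ => h j).trans ?_)
    simp
  refine (measure_mono hsub).trans ((measure_union_le _ _).trans (le_trans (add_le_add
    ((measure_union_le _ _).trans (add_le_add ((measure_union_le _ _).trans (add_le_add
      ((measure_union_le _ _).trans (add_le_add (u1 fun i => u1 fun j => b1 i j)
        (u1 fun i => u1 fun j => b2 i j))) (u1 b3))) b4)) b5) ?_))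
  have hp' : p = ENNReal.ofReal (2 * Real.exp (-(M ^ 2 / 2))) := by
    rw [hp, ENNReal.ofReal_mul zero_le_two]; simp
  have hE := Real.exp_pos (-(M ^ 2 / 2))
  rw [hp', ← ENNReal.ofReal_natCast N, ← ENNReal.ofReal_mul (by positivity),
    ← ENNReal.ofReal_mul (by positivity), ← ENNReal.ofReal_add (by positivity) (by positivity),
    ← ENNReal.ofReal_add (by positivity) (by positivity),
    ← ENNReal.ofReal_add (by positivity) (by positivity),
    ← ENNReal.ofReal_add (by positivity) (by positivity)]
  refine ENNReal.ofReal_le_ofReal ?_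
  have hN1 : (1 : ℝ) ≤ N := by exact_mod_cast hN
  have hNN : (N : ℝ) * (2 * Real.exp (-(M ^ 2 / 2))) ≤
      N * (N * (2 * Real.exp (-(M ^ 2 / 2)))) := by
    exact mul_le_mul_of_nonneg_left (le_mul_of_one_le_left (by positivity) hN1) hNpos.le
  rw [add_div]
  linarith

end Probability

/-! ### Asymptotics -/

lemma abs_ciSup_sub_ciSup_le {ι : Type*} [Finite ι] [Nonempty ι] {f g : ι → ℝ} {t : ℝ}
    (h : ∀ j, |f j - g j| ≤ t) : |(⨆ j, f j) - ⨆ j, g j| ≤ t := by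
  have hf := Set.finite_range f |>.bddAbove
  have hg := Set.finite_range g |>.bddAbove
  rw [abs_sub_le_iff]
  constructor
  · rw [sub_le_iff_le_add]
    exact ciSup_le fun j => by linarith [(abs_sub_le_iff.1 (h j)).1, le_ciSup hg j]
  · rw [sub_le_iff_le_add]
    exact ciSup_le fun j => by linarith [(abs_sub_le_iff.1 (h j)).2, le_ciSup hf j]

lemma tendsto_nat_rpow_atTop {s : ℝ} (hs : 0 < s) :
    Tendsto (fun N : ℕ => (N : ℝ) ^ s) atTop atTop :=
  (tendsto_rpow_atTop hs).comp tendsto_natCast_atTop_atTop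

lemma tendsto_sq_mul_exp_neg_rpow {s : ℝ} (hs : 0 < s) :
    Tendsto (fun N : ℕ => (N : ℝ) ^ 2 * Real.exp (-(((N : ℝ) ^ s) ^ 2 / 2))) atTop (𝓝 0) := by
  have h := (tendsto_rpow_mul_exp_neg_mul_atTop_nhds_zero (2 / (2 * s)) (1 / 2)
    (by norm_num)).comp (tendsto_nat_rpow_atTop (s := 2 * s) (by positivity))
  refine h.congr fun N => ?_
  have hN : (0 : ℝ) ≤ N := Nat.cast_nonneg N
  simp only [Function.comp_apply]
  rw [← Real.rpow_mul hN, mul_div_cancel₀ _ (by positivity : 2 * s ≠ 0), Real.rpow_two,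
    mul_comm 2 s, Real.rpow_mul hN, Real.rpow_two]
  congr 2
  ring

lemma tendsto_mul_rpow_div_sqrt {k : ℕ → ℕ} {δ C : ℝ} (hδ : 0 < δ)
    (hC : ∀ N, 1 ≤ N → (k N : ℝ) ≤ C * (N : ℝ) ^ (1 / 2 - δ)) :
    Tendsto (fun N : ℕ => k N * ((N : ℝ) ^ (δ / 4)) ^ 3 / √(N : ℝ)) atTop (𝓝 0) := by
  have h := ((tendsto_rpow_neg_atTop (y := δ / 4) (by positivity)).comp
    (tendsto_natCast_atTop_atTop (R := ℝ))).const_mul C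
  rw [mul_zero] at h
  refine squeeze_zero' (.of_forall fun N => by positivity) ?_ h
  filter_upwards [eventually_ge_atTop 1] with N hN
  have hN0 : (0 : ℝ) < N := by exact_mod_cast hN
  simp only [Function.comp_apply]
  rw [div_le_iff₀ (Real.sqrt_pos.2 hN0)]
  refine (mul_le_mul_of_nonneg_right (hC N hN) (by positivity)).trans_eq ?_
  rw [mul_assoc, mul_assoc, Real.sqrt_eq_rpow, ← Real.rpow_natCast, ← Real.rpow_mul hN0.le,
    ← Real.rpow_add hN0, ← Real.rpow_add hN0]
  congr 2
  push_cast
  ring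

theorem proposition2p8 {Ω : ℕ → Type*} [∀ N, MeasurableSpace (Ω N)]
    (P : ∀ N, Measure (Ω N)) [∀ N, IsProbabilityMeasure (P N)]
    -- for each `N`, i.i.d. standard Gaussian vectors `y_0, …, y_{N-1}` in `ℝ^N`
    (y : ∀ N : ℕ, Fin N → Ω N → EuclideanSpace ℝ (Fin N))
    (hy_law : ∀ N i, HasLaw (y N i) (stdGaussian (EuclideanSpace ℝ (Fin N))) (P N))
    (hy_indep : ∀ N, iIndepFun (y N) (P N))
    -- positive integers `k_N = O(N^{1/2 - δ})`
    (δ : ℝ) (hδ : 0 < δ) (k : ℕ → ℕ) (hk_pos : ∀ N, 1 ≤ N → 1 ≤ k N)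
    (hk : ∃ C : ℝ, ∀ N, 1 ≤ N → (k N : ℝ) ≤ C * (N : ℝ) ^ (1 / 2 - δ))
    -- for each `m`, a deterministic `m`-tuple `a m 0, …, a m (m - 1)`, all uniformly bounded
    (a : ℕ → ℕ → ℝ) (A : ℝ) (hA : 0 < A) (ha : ∀ m i, i < m → |a m i| ≤ A) :
    TendstoZeroInProb P (fun N ω =>
      (⨆ j : Fin N, |rowForm (k N) (a (k N)) (rescaledGramSchmidt fun i => y N i ω) j|)
        - ⨆ j : Fin N, |rowForm (k N) (a (k N)) (fun i => y N i ω) j|) ∧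
    TendstoZeroInProb P (fun N ω =>
      (⨆ j : Fin N, rowForm (k N) (a (k N)) (rescaledGramSchmidt fun i => y N i ω) j)
        - ⨆ j : Fin N, rowForm (k N) (a (k N)) (fun i => y N i ω) j) := by
  obtain ⟨C, hC⟩ := hk
  obtain ⟨c, hc, hbound⟩ := exists_measure_rowForm_sub_le
  have hδ4 : 0 < δ / 4 := by positivity
  have hr := tendsto_mul_rpow_div_sqrt hδ hC
  have hB : Tendsto (fun N : ℕ => ENNReal.ofReal (6 * (N : ℝ) ^ 2 *
      Real.exp (-(((N : ℝ) ^ (δ / 4)) ^ 2 / 2)) + (c + 1) / (N : ℝ) ^ (δ / 4))) atTop (𝓝 0) := by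
    rw [← ENNReal.ofReal_zero]
    refine ENNReal.tendsto_ofReal ?_
    have h1 := (tendsto_sq_mul_exp_neg_rpow hδ4).const_mul 6
    have h2 := (tendsto_nat_rpow_atTop hδ4).const_div_atTop (c + 1)
    simpa [mul_assoc] using h1.add h2
  -- the claims only depend on the joint law, so they can be read off from the product measure
  have hlaw : ∀ N, (P N).map (fun ω i => y N i ω) =
      Measure.pi fun _ : Fin N => stdGaussian (EuclideanSpace ℝ (Fin N)) := by
    intro N
    rw [(iIndepFun_iff_map_fun_eq_pi_map fun i => (hy_law N i).aemeasurable).1 (hy_indep N)]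
    simp only [(hy_law N _).map_eq]
  -- both claims follow once the difference is bounded by the largest entrywise difference
  have key : ∀ X : ∀ N, Ω N → ℝ,
      (∀ N, 0 < N → ∀ ω t, (∀ j, |rowForm (k N) (a (k N)) (rescaledGramSchmidt fun i => y N i ω) j -
        rowForm (k N) (a (k N)) (fun i => y N i ω) j| ≤ t) → |X N ω| ≤ t) →
      TendstoZeroInProb P X := by
    intro X hX ε hε
    have hr' := hr.const_mul (10 * A)
    rw [mul_zero] at hr'
    refine tendsto_of_tendsto_of_tendsto_of_le_of_le' tendsto_const_nhds hB
      (.of_forall fun _ => zero_le) ?_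
    filter_upwards [eventually_ge_atTop 1, hr.eventually_le_const (by norm_num : (0 : ℝ) < 1 / 4),
      hr'.eventually_lt_const hε] with N hN hr4 hrε
    have hM : 1 ≤ (N : ℝ) ^ (δ / 4) := Real.one_le_rpow (by exact_mod_cast hN) hδ4.le
    refine le_trans ?_ (hbound N (k N) (a (k N)) A _ hN (hk_pos N hN) hA (ha (k N)) hM hr4)
    rw [← hlaw N]
    refine le_trans (measure_mono fun ω hω => ?_) (Measure.le_map_apply
      (aemeasurable_pi_lambda _ fun i => (hy_law N i).aemeasurable) _)
    by_contra hcon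
    simp only [Set.mem_preimage, Set.mem_ofPred_eq, not_exists, not_lt] at hcon
    exact absurd (hX N hN ω _ hcon) (not_le.2 (hrε.trans_le hω))
  constructor
  · refine key _ fun N hN ω t h => ?_
    have : Nonempty (Fin N) := ⟨⟨0, hN⟩⟩
    exact abs_ciSup_sub_ciSup_le fun j => (abs_abs_sub_abs_le_abs_sub _ _).trans (h j)
  · refine key _ fun N hN ω t h => ?_
    have : Nonempty (Fin N) := ⟨⟨0, hN⟩⟩
    exact abs_ciSup_sub_ciSup_le h
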